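/- Let $\&$ be a continuous t-norm on $[0,1]$, i.e. a continuous, commutative, associative operation on $[0,1]$ that is monotone in each variable and has unit $1$, and let $\rightarrow$ be its implication: $x\,\&\,y\le z\iff y\le x\rightarrow z$. A real-enriched category is a set $X$ with a map $X(-,-)\colon X\times X\to[0,1]$ such that $X(x,x)=1$ and $X(y,z)\,\&\,X(x,y)\le X(x,z)$; its opposite is $X^{\rm op}(x,y)=X(y,x)$; a functor $f\colon X\to Y$ is a map with $X(x,y)\le Y(f(x),f(y))$. Let ${\sf V}=[0,1]$ with ${\sf V}(x,y)=x\rightarrow y$. For a set $X$ and $\lambda,\mu\in[0,1]^X$ put ${\rm sub}_X(\lambda,\mu)=\inf_{x\in X}(\lambda(x)\rightarrow\mu(x))$. A weight of a real-enriched category $X$ is a functor $\phi\colon X^{\rm op}\to{\sf V}$; the weights of $X$ form a real-enriched category $\mathcal PX$ with $\mathcal PX(\phi,\psi)={\rm sub}_X(\phi,\psi)$. For a functor $h\colon K\to X$ and a weight $w$ of $K$, an element $b\in X$ is a colimit of $h$ weighted by $w$ if $X(b,x)={\rm sub}_K(w,X(h(-),x))$ for all $x\in X$. An ideal of $X$ is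 a weight $\phi$ such that ${\rm sub}_X(\phi,-)\colon\mathcal PX\to{\sf V}$ preserves all existing weighted colimits of functors $h\colon K\to\mathcal PX$ with $K$ a finite real-enriched category. A filter of $X$ is an ideal of $X^{\rm op}$, and a conical filter of a set $X$ is a filter $\mathfrak F\colon[0,1]^X\to[0,1]$ of the real-enriched category $([0,1]^X,{\rm sub}_X)$. The double contravariant fuzzy powerset monad $(\mathscr E,{\sf m},{\sf e})$ on ${\bf Set}$ is given by $\mathscr EX=[0,1]^{[0,1]^X}$; $\mathscr E(f)(\Lambda)(\mu)=\Lambda(\mu\circ f)$ for $f\colon X\to Y$, $\Lambda\in\mathscr EX$, $\mu\in[0,1]^Y$; ${\sf e}_X(x)(\lambda)=\lambda(x)$; and ${\sf m}_X(\mathcal H)(\lambda)=\mathcal H(\widehat\lambda)$ for $\mathcal H\in\mathscr E\mathscr EX$, where $\widehat\lambda(\Lambda)=\Lambda(\lambda)$. The conical filter functor $\mathscr F$ is the subfunctor of $\mathscr E$ for which $\mathscr FX$ is the set of all conical filters of $X$; let $\mathfrak i\colon\mathscr F\to\mathscr E$ be the inclusion. One says that $\mathscr F$ is a submonad of $(\mathscr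 E,{\sf m},{\sf e})$ if both ${\sf e}$ and ${\sf m}\circ(\mathfrak i*\mathfrak i)$ factor through $\mathfrak i$, where $\mathfrak i*\mathfrak i\colon\mathscr F^2\to\mathscr E^2$ is the horizontal composite. Then the following are equivalent: (1) The implication $\rightarrow\colon[0,1]\times[0,1]\to[0,1]$ is continuous at each point off the diagonal $\{(x,x)\mid x\in[0,1]\}$. (2) The conical filter functor $\mathscr F\colon{\bf Set}\to{\bf Set}$ is a submonad of the double contravariant fuzzy powerset monad $(\mathscr E,{\sf m},{\sf e})$. -/

import Mathlib

open CategoryTheory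

universe u v

/-- A continuous t-norm `&` on the unit interval `[0,1]`. -/
structure ContinuousTNorm where
  /-- the operation `x & y` -/
  op : unitInterval → unitInterval → unitInterval
  comm : ∀ x y, op x y = op y x
  assoc : ∀ x y z, op (op x y) z = op x (op y z)
  mono : ∀ x y z, y ≤ z → op x y ≤ op x z
  op_one : ∀ x, op x 1 = x
  cont : Continuous fun p : unitInterval × unitInterval => op p.1 p.2

namespace ContinuousTNorm

variable (T : ContinuousTNorm)

/-- The implication `x → z`, i.e. the largest `y` with `x & y ≤ z`. -/
noncomputable def imp (x z : unitInterval) : unitInterval :=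
  sSup {y | T.op x y ≤ z}

/-- The implication is continuous at each point off the diagonal. -/
def ImpContinuousOffDiagonal : Prop :=
  ∀ p : unitInterval × unitInterval, p.1 ≠ p.2 →
    ContinuousAt (fun q : unitInterval × unitInterval => T.imp q.1 q.2) p

/-- `sub_X(s, t) = inf_x (s x → t x)` for fuzzy subsets `s, t` of `X`
(the infimum of the empty family being `1`). -/
noncomputable def sub {X : Type u} (s t : X → unitInterval) : unitInterval :=
  ⨅ x, T.imp (s x) (t x)

theorem op_zero (x : unitInterval) : T.op x 0 = 0 := by
  have h := T.mono 0 x 1 (unitInterval.le_one x)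
  rw [T.op_one, T.comm] at h
  exact le_antisymm h (unitInterval.nonneg _)

/-- `x → -` is right adjoint to `x & -`. -/
theorem le_imp_iff (x y z : unitInterval) : y ≤ T.imp x z ↔ T.op x y ≤ z := by
  have hc : IsClosed {y | T.op x y ≤ z} :=
    isClosed_le (T.cont.comp (Continuous.prodMk_right x)) continuous_const
  have hne : {y | T.op x y ≤ z}.Nonempty :=
    ⟨0, (T.op_zero x).trans_le (unitInterval.nonneg z)⟩
  have hm : T.op x (T.imp x z) ≤ z := hc.csSup_mem hne (OrderTop.bddAbove _)
  exact ⟨fun h => (T.mono _ _ _ h).trans hm, fun h => le_sSup h⟩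

theorem op_mono {a b c d : unitInterval} (h : a ≤ b) (k : c ≤ d) : T.op a c ≤ T.op b d := by
  refine (T.mono _ _ _ k).trans ?_
  rw [T.comm a, T.comm b]
  exact T.mono _ _ _ h

theorem op_imp_le (x z : unitInterval) : T.op x (T.imp x z) ≤ z :=
  (T.le_imp_iff _ _ _).1 le_rfl

theorem imp_mono {a b c d : unitInterval} (h : b ≤ a) (k : c ≤ d) : T.imp a c ≤ T.imp b d := by
  rw [le_imp_iff]
  exact (T.op_mono h le_rfl).trans ((T.op_imp_le _ _).trans k)

theorem imp_self (x : unitInterval) : T.imp x x = 1 :=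
  le_antisymm (unitInterval.le_one _) ((T.le_imp_iff _ _ _).2 (T.op_one x).le)

theorem imp_trans (x y z : unitInterval) : T.op (T.imp y z) (T.imp x y) ≤ T.imp x z := by
  rw [le_imp_iff, T.comm (T.imp y z), ← T.assoc]
  exact (T.op_mono (T.op_imp_le _ _) le_rfl).trans (T.op_imp_le _ _)

theorem le_sub_iff {X : Type u} (s t : X → unitInterval) (r : unitInterval) :
    r ≤ T.sub s t ↔ ∀ x, T.op (s x) r ≤ t x := by
  simp only [sub, le_iInf_iff, le_imp_iff]

theorem sub_le {X : Type u} (s t : X → unitInterval) (x : X) :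
    T.op (s x) (T.sub s t) ≤ t x :=
  (T.le_sub_iff s t _).1 le_rfl x

theorem sub_self {X : Type u} (s : X → unitInterval) : T.sub s s = 1 :=
  le_antisymm (unitInterval.le_one _) ((T.le_sub_iff _ _ _).2 fun _ => (T.op_one _).le)

theorem sub_trans {X : Type u} (r s t : X → unitInterval) :
    T.op (T.sub s t) (T.sub r s) ≤ T.sub r t := by
  rw [le_sub_iff]
  intro x
  rw [T.comm (T.sub s t), ← T.assoc]
  exact (T.op_mono (T.sub_le _ _ _) le_rfl).trans (T.sub_le _ _ _)

end ContinuousTNorm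

/-- A real-enriched category (with respect to the continuous t-norm `T`) with set of objects `X`. -/
structure RealCat (T : ContinuousTNorm) (X : Type u) where
  /-- the degree `X(x,y)` -/
  hom : X → X → unitInterval
  refl : ∀ x, hom x x = 1
  trans : ∀ x y z, T.op (hom y z) (hom x y) ≤ hom x z

/-- The real-enriched category `V = ([0,1], →)`. -/
noncomputable def ContinuousTNorm.V (T : ContinuousTNorm) : RealCat T unitInterval where
  hom := T.imp
  refl := T.imp_self
  trans := T.imp_trans

/-- The enriched powerset `([0,1]^X, sub_X)` of a set `X`. -/
noncomputable def ContinuousTNorm.powerset (T : ContinuousTNorm) (X : Type u) :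
    RealCat T (X → unitInterval) where
  hom := T.sub
  refl := T.sub_self
  trans := T.sub_trans

namespace RealCat

variable {T : ContinuousTNorm}

/-- The opposite real-enriched category. -/
def op {X : Type u} (A : RealCat T X) : RealCat T X where
  hom x y := A.hom y x
  refl := A.refl
  trans x y z := by rw [T.comm]; exact A.trans z y x

/-- Functors between real-enriched categories. -/
def IsFunctor {X : Type u} {Y : Type v} (A : RealCat T X) (B : RealCat T Y) (f : X → Y) : Prop :=
  ∀ x y, A.hom x y ≤ B.hom (f x) (f y)

/-- A weight of `A` is a functor from the opposite of `A` to `V`. -/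
def IsWeight {X : Type u} (A : RealCat T X) (φ : X → unitInterval) : Prop :=
  A.op.IsFunctor T.V φ

/-- The real-enriched category `P A` of weights of `A`. -/
noncomputable def presheaf {X : Type u} (A : RealCat T X) :
    RealCat T {φ : X → unitInterval // A.IsWeight φ} where
  hom φ ψ := T.sub φ.1 ψ.1
  refl φ := T.sub_self φ.1
  trans φ ψ χ := T.sub_trans φ.1 ψ.1 χ.1

/-- `b` is a colimit of `h : K → X` weighted by `w`:
`X(b, x) = sub_K(w, X(h -, x))` for all `x`. -/
def IsColimit {K : Type v} {X : Type u} (A : RealCat T X)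
    (w : K → unitInterval) (h : K → X) (b : X) : Prop :=
  ∀ x, A.hom b x = T.sub w fun k => A.hom (h k) x

/-- `f` preserves all existing colimits of functors from finite real-enriched categories. -/
def PreservesFiniteColimits {X : Type u} {Y : Type v} (A : RealCat T X) (B : RealCat T Y)
    (f : X → Y) : Prop :=
  ∀ (K : Type) [Finite K] (C : RealCat T K) (h : K → X) (w : K → unitInterval) (b : X),
    C.IsFunctor A h → C.IsWeight w → A.IsColimit w h b →
      B.IsColimit w (fun k => f (h k)) (f b)

/-- An ideal of `A` is a weight `φ` such that `sub_A(φ, -) : P A → V` preserves finite colimits. -/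
def IsIdeal {X : Type u} (A : RealCat T X) (φ : X → unitInterval) : Prop :=
  A.IsWeight φ ∧ A.presheaf.PreservesFiniteColimits T.V fun χ => T.sub φ χ.1

/-- A filter of `A` is an ideal of the opposite of `A`. -/
def IsFilter {X : Type u} (A : RealCat T X) (ψ : X → unitInterval) : Prop :=
  A.op.IsIdeal ψ

theorem isWeight_iff {X : Type u} {A : RealCat T X} {φ : X → unitInterval} :
    A.IsWeight φ ↔ ∀ x y, T.op (φ y) (A.hom x y) ≤ φ x :=
  ⟨fun h x y => (T.le_imp_iff _ _ _).1 (h y x), fun h x y => (T.le_imp_iff _ _ _).2 (h y x)⟩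

/-- If `l` is left adjoint to the functor `g`, then precomposing an ideal with `l` gives an
ideal. -/
theorem IsIdeal.comp_leftAdjoint {X : Type u} {Y : Type v} {A : RealCat T X} {B : RealCat T Y}
    {l : Y → X} {g : X → Y} (hl : B.IsFunctor A l) (hg : A.IsFunctor B g)
    (adj : ∀ y x, A.hom (l y) x = B.hom y (g x)) {φ : X → unitInterval} (hφ : A.IsIdeal φ) :
    B.IsIdeal fun y => φ (l y) := by
  have hwB : B.IsWeight fun y => φ (l y) := fun x y => (hl y x).trans (hφ.1 (l x) (l y))
  have hwg : ∀ ξ : Y → unitInterval, B.IsWeight ξ → A.IsWeight fun x => ξ (g x) :=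
    fun ξ hξ x y => (hg y x).trans (hξ (g x) (g y))
  -- the value of `sub` at the transported weight
  have key : ∀ ξ : Y → unitInterval, B.IsWeight ξ →
      T.sub (fun y => φ (l y)) ξ = T.sub φ fun x => ξ (g x) := by
    intro ξ hξ
    apply le_antisymm
    · rw [ContinuousTNorm.le_sub_iff]
      intro x
      refine le_trans (T.op_mono ?_ le_rfl) (T.sub_le (fun y => φ (l y)) ξ (g x))
      have h := isWeight_iff.1 hφ.1 (l (g x)) x
      rwa [adj, B.refl, T.op_one] at h
    · rw [ContinuousTNorm.le_sub_iff]
      intro y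
      refine (T.sub_le φ (fun x => ξ (g x)) (l y)).trans ?_
      have h := isWeight_iff.1 hξ y (g (l y))
      rwa [← adj, A.refl, T.op_one] at h
  refine ⟨hwB, ?_⟩
  intro K _ C h w b hh hw hb
  have h1 := hφ.2 K C (fun k => ⟨fun x => (h k).1 (g x), hwg _ (h k).2⟩) w
    ⟨fun x => b.1 (g x), hwg _ b.2⟩ ?_ hw ?_
  · intro v
    simp only [key _ b.2, fun k => key _ (h k).2]
    exact h1 v
  · intro k k'
    refine (hh k k').trans ?_
    refine (T.le_sub_iff _ _ _).2 fun x => ?_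
    exact T.sub_le (h k).1 (h k').1 (g x)
  · -- precomposition with `g` has a right adjoint, so it preserves colimits
    intro y
    let r : Y → unitInterval := fun β => ⨅ x, T.imp (B.hom (g x) β) (y.1 x)
    have hr : B.IsWeight r := by
      rw [isWeight_iff]
      intro β β'
      refine le_iInf fun x => ?_
      rw [T.le_imp_iff]
      have h1 : T.op (B.hom (g x) β') (r β') ≤ y.1 x :=
        (T.le_imp_iff _ _ _).1 (iInf_le _ x)
      refine le_trans ?_ h1
      rw [T.comm (r β'), ← T.assoc]
      refine T.op_mono ?_ le_rfl
      rw [T.comm]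
      exact B.trans _ _ _
    have hadj : ∀ ξ : Y → unitInterval, B.IsWeight ξ →
        T.sub (fun x => ξ (g x)) y.1 = T.sub ξ r := by
      intro ξ hξ
      apply le_antisymm
      · rw [ContinuousTNorm.le_sub_iff]
        intro β
        refine le_iInf fun x => ?_
        rw [T.le_imp_iff, ← T.assoc]
        refine (T.op_mono ?_ le_rfl).trans (T.sub_le (fun x => ξ (g x)) y.1 x)
        rw [T.comm]
        exact isWeight_iff.1 hξ _ _
      · rw [ContinuousTNorm.le_sub_iff]
        intro x
        refine (T.sub_le ξ r (g x)).trans ((iInf_le _ x).trans ?_)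
        rw [B.refl]
        have h2 := T.op_imp_le 1 (y.1 x)
        rwa [T.comm, T.op_one] at h2
    have h3 := hb ⟨r, hr⟩
    simp only [presheaf] at h3 ⊢
    rw [hadj _ b.2, h3]
    simp only [fun k => hadj _ (h k).2]

end RealCat

/-- A conical filter of a set `X` is a filter of `([0,1]^X, sub_X)`. -/
def ContinuousTNorm.IsConicalFilter (T : ContinuousTNorm) {X : Type u}
    (Λ : (X → unitInterval) → unitInterval) : Prop :=
  (T.powerset X).IsFilter Λ

/-- The image of a conical filter under a map is a conical filter. -/
theorem ContinuousTNorm.IsConicalFilter.map {T : ContinuousTNorm} {X : Type u} {Y : Type v}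
    (f : X → Y) {Λ : (X → unitInterval) → unitInterval} (h : T.IsConicalFilter Λ) :
    T.IsConicalFilter fun μ : Y → unitInterval => Λ fun x => μ (f x) := by
  have hadj : ∀ (μ : Y → unitInterval) (s : X → unitInterval),
      T.sub s (fun x => μ (f x)) = T.sub (fun y => ⨆ x : {x // f x = y}, s x.1) μ := by
    intro μ s
    apply le_antisymm
    · rw [le_sub_iff]
      intro y
      rw [T.comm, ← T.le_imp_iff]
      refine iSup_le ?_
      rintro ⟨x, rfl⟩
      rw [T.le_imp_iff, T.comm]
      exact T.sub_le s (fun x => μ (f x)) x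
    · rw [le_sub_iff]
      intro x
      refine le_trans (T.op_mono ?_ le_rfl)
        (T.sub_le (fun y => ⨆ x : {x // f x = y}, s x.1) μ (f x))
      exact le_iSup (fun x' : {x' // f x' = f x} => s x'.1) ⟨x, rfl⟩
  refine RealCat.IsIdeal.comp_leftAdjoint (l := fun (μ : Y → unitInterval) x => μ (f x))
    (g := fun s y => ⨆ x : {x // f x = y}, s x.1) ?_ ?_ (fun μ s => hadj μ s) h
  · intro μ ν
    exact (T.le_sub_iff _ _ _).2 fun x => T.sub_le ν μ (f x)
  · intro s t
    change T.sub t s ≤ T.sub _ _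
    rw [← hadj, le_sub_iff]
    intro x
    exact (T.sub_le t s x).trans (le_iSup (fun x' : {x' // f x' = f x} => s x'.1) ⟨x, rfl⟩)

/-- The double contravariant fuzzy powerset monad on the category of sets, i.e. the monad induced
by the self-adjunction of the contravariant functor `X ↦ [0,1]^X`. -/
def doubleFuzzyPowerset : Monad (Type u) where
  obj X := (X → unitInterval) → unitInterval
  map f := TypeCat.ofHom fun Λ μ => Λ fun x => μ (f x)
  η := { app := fun X => TypeCat.ofHom fun x s => s x }
  μ := { app := fun X => TypeCat.ofHom fun H s => H fun Λ => Λ s }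

/-- A subfunctor `G` of (the functor part of) a monad on the category of sets is a submonad if the
unit and the multiplication restrict to `G`: the unit factors through the inclusion `i : G → T`,
and so does `μ ∘ (i * i)`, with `i * i : G² → T²` the horizontal composite. -/
def IsSubmonad (T : Monad (Type u)) (G : Subfunctor T.toFunctor) : Prop :=
  (∃ e : 𝟭 (Type u) ⟶ G.toFunctor, e ≫ G.ι = T.η) ∧
    ∃ m : G.toFunctor ⋙ G.toFunctor ⟶ G.toFunctor, m ≫ G.ι = (G.ι ◫ G.ι) ≫ T.μ

/-- The conical filter functor, as a subfunctor of the double contravariant fuzzy powerset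
functor. -/
def ContinuousTNorm.conicalFilterFunctor (T : ContinuousTNorm) :
    Subfunctor doubleFuzzyPowerset.{u}.toFunctor where
  obj X := {Λ : (X → unitInterval) → unitInterval | T.IsConicalFilter Λ}
  map f _ hΛ := ContinuousTNorm.IsConicalFilter.map f hΛ

/-! A conical filter `Λ` is governed by the lattice filter of those `ξ` with `Λ ξ = 1`. It is
characterised by four conditions: `Λ 1 = 1`, compatibility with `sub`, preservation of binary meets,
and `Λ (a → s) = 1` whenever `a < Λ s` (necessity in `apply_one`, `op_sub_le`, `inf_le`,
`apply_imp_eq_one`; sufficiency in `isConicalFilter_of`). The monad multiplication preserves the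
first three for every t-norm. The fourth needs `b → Λ s ≤ Λ (b → s)` for `Λ s < b`, which follows
from left continuity of `b → -` at `Λ s`. Conversely, off-diagonal continuity can fail only through
left continuity in the second argument at some `0 < s < b`. The filter generated by the intervals
`[c, s)`, `c < s`, detects the jump, and a principal filter on the set of conical filters turns it
into a product violating the fourth condition. -/

namespace ContinuousTNorm

variable (T : ContinuousTNorm)

/-! ### Continuity of the implication off the diagonal. -/

theorem one_le_iff_eq_one {x : unitInterval} : 1 ≤ x ↔ x = 1 :=
  ⟨fun h => le_antisymm (unitInterval.le_one x) h, fun h => h.ge⟩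

theorem one_op (x : unitInterval) : T.op 1 x = x := by
  rw [T.comm, T.op_one]

theorem op_le_left (x y : unitInterval) : T.op x y ≤ x :=
  (T.mono x y 1 (unitInterval.le_one y)).trans (T.op_one x).le

theorem op_le_right (x y : unitInterval) : T.op x y ≤ y :=
  (T.comm x y).trans_le (T.op_le_left y x)

theorem le_imp_comm {x y z : unitInterval} : y ≤ T.imp x z ↔ x ≤ T.imp y z := by
  rw [le_imp_iff, le_imp_iff, T.comm]

theorem imp_eq_one_iff {x y : unitInterval} : T.imp x y = 1 ↔ x ≤ y := by
  rw [← T.op_one x, ← le_imp_iff, T.op_one, one_le_iff_eq_one]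

theorem one_imp (x : unitInterval) : T.imp 1 x = x :=
  eq_of_forall_le_iff fun y => by rw [le_imp_iff, one_op]

theorem sub_eq_one_iff {X : Type u} {s t : X → unitInterval} : T.sub s t = 1 ↔ s ≤ t := by
  rw [← one_le_iff_eq_one, le_sub_iff]
  simp only [op_one, Pi.le_def]

/-- Every continuous t-norm is divisible. -/
theorem op_imp_of_le {x y : unitInterval} (h : y ≤ x) : T.op x (T.imp x y) = y := by
  have hc : Continuous fun t => T.op x t := T.cont.comp (Continuous.prodMk_right x)
  obtain ⟨t, ht⟩ := mem_range_of_exists_le_of_exists_ge hc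
    ⟨0, (T.op_zero x).trans_le (unitInterval.nonneg y)⟩ ⟨1, h.trans (T.op_one x).ge⟩
  exact le_antisymm (T.op_imp_le x y)
    (ht.ge.trans (T.mono _ _ _ ((T.le_imp_iff _ _ _).2 ht.le)))

/-- Off the diagonal, the implication is right continuous in its first argument. -/
theorem exists_lt_imp_of_lt_imp {b s r : unitInterval} (hsb : s < b) (hb : b < 1)
    (hr : r < T.imp b s) : ∃ b', b < b' ∧ r < T.imp b' s := by
  obtain ⟨r₁, hr₁, hr₁'⟩ := exists_between hr
  set r' := T.imp b s
  by_contra! hcon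
  set t := T.imp r' r₁
  have hrt : T.op r' t = r₁ := T.op_imp_of_le hr₁'.le
  -- all elements above `b` stay above `b` when multiplied by `t`
  have h1 : ∀ b', b < b' → b ≤ T.op b' t := by
    intro b' hb'
    by_contra! hlt
    refine (hcon b' hb').not_gt (hr₁.trans_le ?_)
    rw [le_imp_iff, ← hrt, T.comm r', ← T.assoc]
    exact (T.op_mono hlt.le le_rfl).trans (T.op_imp_le b s)
  have hbt : b ≤ T.op b t := by
    have hc : Continuous fun x => T.op x t := T.cont.comp (Continuous.prodMk_left t)
    have hcl : IsClosed {x | b ≤ T.op x t} := isClosed_le continuous_const hc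
    have hsub : closure (Set.Ioi b) ⊆ {x | b ≤ T.op x t} := hcl.closure_subset_iff.2 h1
    rw [closure_Ioi' (⟨1, hb⟩ : (Set.Ioi b).Nonempty)] at hsub
    exact hsub Set.self_mem_Ici
  -- The least `e` with `b ≤ b & e` is attained by continuity and is idempotent by minimality.
  let S : Set unitInterval := {x | b ≤ T.op b x}
  have hScl : IsClosed S :=
    isClosed_le continuous_const (T.cont.comp (Continuous.prodMk_right b))
  have he : sInf S ∈ S := hScl.sInf_mem ⟨t, hbt⟩
  set e := sInf S
  have het : e ≤ t := sInf_le hbt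
  have hee : e ≤ T.op e e := by
    refine sInf_le ?_
    change b ≤ _
    rw [← T.assoc]
    exact (show b ≤ T.op b e from he).trans (T.op_mono he le_rfl)
  -- Below the idempotent `e`, divisibility makes `e` act as a unit, so `r' ≤ r' & t = r₁`. Above
  -- it, `b ≤ b & e ≤ b & r' ≤ s`.
  rcases le_total r' e with h | h
  · have h2 : r' ≤ r₁ := by
      rw [← hrt]
      refine le_trans ?_ (T.mono r' e t het)
      conv_lhs => rw [← T.op_imp_of_le h]
      conv_rhs => rw [← T.op_imp_of_le h, T.comm, ← T.assoc]
      exact T.op_mono hee le_rfl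
    exact h2.not_gt hr₁'
  · have h2 : b ≤ s := (show b ≤ T.op b e from he).trans
      ((T.mono b e r' h).trans (T.op_imp_le b s))
    exact h2.not_gt hsb

/-- The implication is continuous off the diagonal provided that it is left continuous in its
second argument there. -/
theorem impContinuousOffDiagonal_of_forall_exists
    (H : ∀ b s r : unitInterval, s < b → 0 < s → r < T.imp b s → ∃ c < s, r < T.imp b c) :
    T.ImpContinuousOffDiagonal := by
  rintro ⟨b, s⟩ hne
  refine tendsto_order.2 ⟨fun r hr => ?_, fun r hr => ?_⟩
  · change r < T.imp b s at hr
    rcases lt_or_gt_of_ne (show b ≠ s from hne) with hlt | hlt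
    · have : ∀ᶠ q : unitInterval × unitInterval in nhds (b, s), q.1 < q.2 :=
        (isOpen_lt continuous_fst continuous_snd).mem_nhds hlt
      filter_upwards [this] with q hq
      rw [T.imp_eq_one_iff.2 hq.le]
      exact hr.trans_le (unitInterval.le_one _)
    · rcases (show (0 : unitInterval) ≤ s from unitInterval.nonneg s).eq_or_lt with h0 | h0
      · rcases (show b ≤ 1 from unitInterval.le_one b).eq_or_lt with h1 | h1
        · rw [h1, one_imp, ← h0] at hr
          exact absurd hr (unitInterval.nonneg r).not_gt
        · obtain ⟨b', hb', hr'⟩ := T.exists_lt_imp_of_lt_imp hlt h1 hr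
          have : ∀ᶠ q : unitInterval × unitInterval in nhds (b, s), q.1 < b' :=
            (isOpen_lt continuous_fst continuous_const).mem_nhds hb'
          filter_upwards [this] with q hq
          refine hr'.trans_le (T.imp_mono hq.le ?_)
          rw [← h0]
          exact unitInterval.nonneg _
      · obtain ⟨c, hc, hr'⟩ := H b s r hlt h0 hr
        have hc1 : Continuous fun q : unitInterval × unitInterval => T.op q.1 (T.imp b c) :=
          T.cont.comp (continuous_fst.prodMk continuous_const)
        have : ∀ᶠ q : unitInterval × unitInterval in nhds (b, s), T.op q.1 (T.imp b c) < q.2 :=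
          (isOpen_lt hc1 continuous_snd).mem_nhds ((T.op_imp_le b c).trans_lt hc)
        -- Near `(b, s)` the product `q.1 & (b → c)` stays below `q.2`, because at `(b, s)` it is at
        -- most `c < s`.
        filter_upwards [this] with q hq
        exact hr'.trans_le ((T.le_imp_iff _ _ _).2 hq.le)
  -- Upper semicontinuity is automatic: by adjunction it is an open condition on `&`.
  · change T.imp b s < r at hr
    have hlt : s < T.op b r := by
      by_contra! h
      exact ((T.le_imp_iff _ _ _).2 h).not_gt hr
    have hc1 : Continuous fun q : unitInterval × unitInterval => T.op q.1 r :=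
      T.cont.comp (continuous_fst.prodMk continuous_const)
    have : ∀ᶠ q : unitInterval × unitInterval in nhds (b, s), q.2 < T.op q.1 r :=
      (isOpen_lt continuous_snd hc1).mem_nhds hlt
    filter_upwards [this] with q hq
    by_contra! h
    exact ((T.le_imp_iff _ _ _).1 h).not_gt hq

theorem ImpContinuousOffDiagonal.exists_lt {T : ContinuousTNorm}
    (H : T.ImpContinuousOffDiagonal) {b s r : unitInterval} (hsb : s < b) (hs : 0 < s)
    (hr : r < T.imp b s) : ∃ c < s, r < T.imp b c := by
  have hc : ContinuousAt (fun c => T.imp b c) s :=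
    ContinuousAt.comp (f := fun c : unitInterval => (b, c)) (H (b, s) hsb.ne')
      (Continuous.prodMk_right b).continuousAt
  obtain ⟨l, hl, hl'⟩ := exists_Ioc_subset_of_mem_nhds (hc.eventually (lt_mem_nhds hr)) ⟨0, hs⟩
  obtain ⟨c, hc1, hc2⟩ := exists_between hl
  exact ⟨c, hc2, hl' ⟨hc1, hc2.le⟩⟩

end ContinuousTNorm

/-! ### Ideals and finite weighted colimits of weights. -/

namespace RealCat

variable {T : ContinuousTNorm} {X : Type u} {A : RealCat T X} {φ : X → unitInterval}

theorem isWeight_const (r : unitInterval) : A.IsWeight fun _ => r :=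
  isWeight_iff.2 fun _ _ => T.op_le_left _ _

theorem isWeight_sup {ψ χ : X → unitInterval} (hψ : A.IsWeight ψ) (hχ : A.IsWeight χ) :
    A.IsWeight (ψ ⊔ χ) := by
  rw [isWeight_iff] at hψ hχ ⊢
  intro x y
  rw [T.comm, ← T.le_imp_iff]
  refine sup_le ?_ ?_
  · rw [T.le_imp_iff, T.comm]
    exact (hψ x y).trans le_sup_left
  · rw [T.le_imp_iff, T.comm]
    exact (hχ x y).trans le_sup_right

theorem isWeight_imp_hom (a : X) (r : unitInterval) : A.IsWeight fun x => T.imp (A.hom a x) r := by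
  rw [isWeight_iff]
  intro x y
  rw [T.le_imp_iff, T.comm (T.imp _ _), ← T.assoc, T.comm (A.hom a x)]
  exact (T.op_mono (A.trans a x y) le_rfl).trans (T.op_imp_le _ _)

/-- On the one-object category, the colimit of the constant weight `1` weighted by `r` is the
constant weight `r`. -/
theorem IsIdeal.sub_const (h : A.IsIdeal φ) (r : unitInterval) : T.sub φ (fun _ => r) = r := by
  refine le_antisymm ?_ ((T.le_sub_iff _ _ _).2 fun x => T.op_le_right _ _)
  have h1 := h.2 Unit ⟨fun _ _ => 1, fun _ => rfl, fun _ _ _ => (T.op_one 1).le⟩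
    (fun _ => ⟨fun _ => 1, isWeight_const 1⟩) (fun _ => r) ⟨fun _ => r, isWeight_const r⟩
    (fun _ _ => (T.sub_self _).ge) (isWeight_const r) ?_
  · have h2 := h1 r
    have h3 : T.sub φ (fun _ => 1) = 1 := T.sub_eq_one_iff.2 fun _ => unitInterval.le_one _
    simp only [h3] at h2
    refine T.imp_eq_one_iff.1 (h2.trans (T.sub_eq_one_iff.2 fun _ => ?_))
    exact (T.one_imp r).ge
  · intro χ
    refine eq_of_forall_le_iff fun s => ?_
    simp only [presheaf, ContinuousTNorm.le_sub_iff, T.one_op, forall_const]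

/-- Binary joins are colimits over the discrete two-object category with weight `1`. -/
theorem IsIdeal.sub_sup_le (h : A.IsIdeal φ) {ψ χ : X → unitInterval} (hψ : A.IsWeight ψ)
    (hχ : A.IsWeight χ) : T.sub φ (ψ ⊔ χ) ≤ T.sub φ ψ ⊔ T.sub φ χ := by
  classical
  have h1 := h.2 Bool ⟨fun i j => if i = j then 1 else 0, fun _ => if_pos rfl, fun x y z => ?_⟩
    (fun i => if i then ⟨ψ, hψ⟩ else ⟨χ, hχ⟩) (fun _ => 1) ⟨ψ ⊔ χ, isWeight_sup hψ hχ⟩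
    (fun i j => ?_) (isWeight_const 1) ?_
  · refine T.imp_eq_one_iff.1 ((h1 _).trans (T.sub_eq_one_iff.2 ?_))
    intro i
    refine (T.imp_eq_one_iff.2 ?_).ge
    cases i
    · exact le_sup_right
    · exact le_sup_left
  · by_cases h1 : x = y
    · subst h1
      rw [if_pos rfl, T.op_one]
    · rw [if_neg h1, T.op_zero]
      exact unitInterval.nonneg _
  · by_cases h1 : i = j
    · subst h1
      rw [A.presheaf.refl]
      exact unitInterval.le_one _
    · simp only [if_neg h1]
      exact unitInterval.nonneg _
  · intro ξ
    refine eq_of_forall_le_iff fun s => ?_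
    simp only [presheaf, ContinuousTNorm.le_sub_iff, T.one_op, Bool.forall_bool, if_true,
      Bool.false_eq_true, if_false, ← forall_and]
    refine forall_congr' fun x => ?_
    rw [T.comm, ← T.le_imp_iff, Pi.sup_apply, sup_le_iff, T.le_imp_iff, T.le_imp_iff,
      T.comm s, T.comm s, and_comm]

/-- In the category of weights, weighted colimits are computed pointwise. -/
theorem isColimit_presheaf_apply {K : Type v} {w : K → unitInterval}
    {h : K → {φ : X → unitInterval // A.IsWeight φ}} {b : {φ : X → unitInterval // A.IsWeight φ}}
    (hb : A.presheaf.IsColimit w h b) (x : X) : b.1 x = ⨆ k, T.op (w k) ((h k).1 x) := by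
  have hle : ∀ χ : {φ : X → unitInterval // A.IsWeight φ},
      b.1 ≤ χ.1 ↔ ∀ k y, T.op (w k) ((h k).1 y) ≤ χ.1 y := by
    intro χ
    rw [← T.sub_eq_one_iff, show T.sub b.1 χ.1 = _ from hb χ, T.sub_eq_one_iff]
    refine forall_congr' fun k => ?_
    simp only [presheaf, T.le_sub_iff]
    exact forall_congr' fun y => by rw [T.comm]
  refine le_antisymm ?_ (iSup_le fun k => (hle b).1 le_rfl k x)
  have hw : A.IsWeight fun x => ⨆ k, T.op (w k) ((h k).1 x) := by
    rw [isWeight_iff]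
    intro y z
    rw [T.comm, ← T.le_imp_iff]
    refine iSup_le fun k => ?_
    rw [T.le_imp_iff, T.comm, T.assoc]
    exact (T.mono _ _ _ (isWeight_iff.1 (h k).2 y z)).trans
      (le_iSup (fun k => T.op (w k) ((h k).1 y)) k)
  exact (hle ⟨_, hw⟩).2 (fun k y => le_iSup (fun k => T.op (w k) ((h k).1 y)) k) x

end RealCat

/-! ### Characterisation of conical filters by four conditions. -/

namespace ContinuousTNorm

variable {T : ContinuousTNorm} {X : Type u} {Λ : (X → unitInterval) → unitInterval}

theorem isWeight_powerset_op_iff :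
    (T.powerset X).op.IsWeight Λ ↔ ∀ s t, T.op (Λ s) (T.sub s t) ≤ Λ t :=
  RealCat.isWeight_iff.trans forall_comm

theorem IsConicalFilter.op_sub_le (h : T.IsConicalFilter Λ) (s t : X → unitInterval) :
    T.op (Λ s) (T.sub s t) ≤ Λ t :=
  isWeight_powerset_op_iff.1 h.1 s t

theorem IsConicalFilter.mono (h : T.IsConicalFilter Λ) {s t : X → unitInterval} (hst : s ≤ t) :
    Λ s ≤ Λ t := by
  have := h.op_sub_le s t
  rwa [T.sub_eq_one_iff.2 hst, T.op_one] at this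

theorem IsConicalFilter.apply_one (h : T.IsConicalFilter Λ) : Λ (fun _ => 1) = 1 := by
  rw [← one_le_iff_eq_one, ← RealCat.IsIdeal.sub_const h (Λ fun _ => 1), one_le_iff_eq_one,
    T.sub_eq_one_iff]
  exact fun s => h.mono fun _ => unitInterval.le_one _

/-- A Yoneda argument: these weights test upper bounds of `Λ s`, so preservation of joins can be
applied to them. -/
theorem IsConicalFilter.sub_imp_eq_one_iff (h : T.IsConicalFilter Λ) (s : X → unitInterval)
    (r : unitInterval) : T.sub Λ (fun z => T.imp (T.sub z s) r) = 1 ↔ Λ s ≤ r := by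
  rw [T.sub_eq_one_iff]
  constructor
  · intro h1
    have h2 := h1 s
    simpa only [T.sub_self, T.one_imp] using h2
  · intro h1 z
    rw [T.le_imp_iff, T.comm]
    exact (h.op_sub_le z s).trans h1

theorem IsConicalFilter.inf_le (h : T.IsConicalFilter Λ) (s t : X → unitInterval) :
    Λ s ⊓ Λ t ≤ Λ (s ⊓ t) := by
  have h1 := RealCat.IsIdeal.sub_sup_le h
    (RealCat.isWeight_imp_hom (A := (T.powerset X).op) s (Λ (s ⊓ t)))
    (RealCat.isWeight_imp_hom (A := (T.powerset X).op) t (Λ (s ⊓ t)))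
  have h2 : T.sub Λ ((fun z => T.imp (T.sub z s) (Λ (s ⊓ t))) ⊔
      fun z => T.imp (T.sub z t) (Λ (s ⊓ t))) = 1 := by
    rw [T.sub_eq_one_iff]
    intro z
    have hz := T.sub_eq_one_iff.1 ((h.sub_imp_eq_one_iff (s ⊓ t) _).2 le_rfl) z
    refine hz.trans ?_
    rcases le_total (T.sub z s) (T.sub z t) with hle | hle
    · refine le_sup_of_le_left (T.imp_mono ?_ le_rfl)
      exact (T.le_sub_iff _ _ _).2 fun x => le_inf (T.sub_le z s x)
        ((T.mono _ _ _ hle).trans (T.sub_le z t x))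
    · refine le_sup_of_le_right (T.imp_mono ?_ le_rfl)
      exact (T.le_sub_iff _ _ _).2 fun x => le_inf
        ((T.mono _ _ _ hle).trans (T.sub_le z s x)) (T.sub_le z t x)
  have h3 := h2.ge.trans h1
  rcases le_sup_iff.1 h3 with h4 | h4
  · exact inf_le_of_left_le ((h.sub_imp_eq_one_iff s _).1 (one_le_iff_eq_one.1 h4))
  · exact inf_le_of_right_le ((h.sub_imp_eq_one_iff t _).1 (one_le_iff_eq_one.1 h4))

/-- For each `t < 1` some `z` has `t < Λ z` and `a < sub z s`, whence `z ≤ (a → s)`. Otherwise `Λ`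
lies below the join of `sub - s → a` and the constant `t`, hence below one of them, giving `Λ s ≤ a`
or `1 ≤ t`. -/
theorem IsConicalFilter.apply_imp_eq_one (h : T.IsConicalFilter Λ) {a : unitInterval}
    {s : X → unitInterval} (ha : a < Λ s) : Λ (fun x => T.imp a (s x)) = 1 := by
  rw [← one_le_iff_eq_one]
  refine le_of_forall_lt fun t ht => ?_
  obtain ⟨z, hz, hz'⟩ : ∃ z, t < Λ z ∧ a < T.sub z s := by
    by_contra! hcon
    have h1 := RealCat.IsIdeal.sub_sup_le h
      (RealCat.isWeight_imp_hom (A := (T.powerset X).op) s a)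
      (RealCat.isWeight_const (A := (T.powerset X).op) t)
    rw [RealCat.IsIdeal.sub_const h] at h1
    have h2 : T.sub Λ ((fun z => T.imp (T.sub z s) a) ⊔ fun _ => t) = 1 := by
      rw [T.sub_eq_one_iff]
      intro z
      rcases lt_or_ge t (Λ z) with hlt | hle
      · refine le_sup_of_le_left ?_
        simp only [T.imp_eq_one_iff.2 (hcon z hlt)]
        exact unitInterval.le_one _
      · exact le_sup_of_le_right hle
    rcases le_sup_iff.1 (h2.ge.trans h1) with h4 | h4
    · exact ((h.sub_imp_eq_one_iff s a).1 (one_le_iff_eq_one.1 h4)).not_gt ha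
    · exact h4.not_gt ht
  refine hz.trans_le (h.mono fun x => ?_)
  rw [T.le_imp_iff, T.comm]
  exact (T.mono _ _ _ hz'.le).trans (T.sub_le z s x)

/-- A map on the fuzzy powerset that behaves like the supremum of `sub ξ` over the elements `ξ`
of a filter of the lattice `[0,1]^X` is a conical filter. -/
theorem isConicalFilter_of (h1 : Λ (fun _ => 1) = 1)
    (hw : ∀ s t, T.op (Λ s) (T.sub s t) ≤ Λ t) (hinf : ∀ s t, Λ s ⊓ Λ t ≤ Λ (s ⊓ t))
    (himp : ∀ a s, a < Λ s → Λ (fun x => T.imp a (s x)) = 1) : T.IsConicalFilter Λ := by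
  refine ⟨isWeight_powerset_op_iff.2 hw, ?_⟩
  -- `sub Λ ψ` is the infimum of `ψ` over `{ξ | Λ ξ = 1}`. Since this set is directed downwards, the
  -- infimum commutes with the finite joins that compute colimits.
  have hsub : ∀ {ψ}, (T.powerset X).op.IsWeight ψ → ∀ r,
      r ≤ T.sub Λ ψ ↔ ∀ ξ, Λ ξ = 1 → r ≤ ψ ξ := by
    intro ψ hψ r
    rw [isWeight_powerset_op_iff] at hψ
    rw [T.le_sub_iff]
    constructor
    · intro h ξ hξ
      simpa only [hξ, T.one_op] using h ξ
    · intro h s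
      rw [T.comm, ← T.le_imp_iff]
      refine le_of_forall_lt_imp_le_of_dense fun a ha => ?_
      rw [T.le_imp_iff]
      refine (T.op_mono (h _ (himp a s ha)) ?_).trans (hψ (fun x => T.imp a (s x)) s)
      refine (T.le_sub_iff _ _ _).2 fun x => ?_
      rw [T.comm]
      exact T.op_imp_le _ _
  have hmono : ∀ {ψ : (X → unitInterval) → unitInterval}, (T.powerset X).op.IsWeight ψ →
      Monotone ψ := by
    intro ψ hψ s t hst
    have := isWeight_powerset_op_iff.1 hψ s t
    rwa [T.sub_eq_one_iff.2 hst, T.op_one] at this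
  have hfin : ∀ {ι : Type} (J : Finset ι) (ξ : ι → X → unitInterval), (∀ i, Λ (ξ i) = 1) →
      ∃ ζ, Λ ζ = 1 ∧ ∀ i ∈ J, ζ ≤ ξ i := by
    intro ι J ξ hξ
    classical
    induction J using Finset.induction_on with
    | empty => exact ⟨_, h1, fun i hi => absurd hi (Finset.notMem_empty i)⟩
    | insert i J _ ih =>
      obtain ⟨ζ, hζ, hζ'⟩ := ih
      refine ⟨ξ i ⊓ ζ, ?_, fun j hj => ?_⟩
      · have := hinf (ξ i) ζ
        rwa [hξ, hζ, inf_idem, one_le_iff_eq_one] at this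
      · rcases Finset.mem_insert.1 hj with rfl | hj
        · exact inf_le_left
        · exact inf_le_right.trans (hζ' j hj)
  intro K _ C h w b hh hC hb
  have := Fintype.ofFinite K
  have hpt := RealCat.isColimit_presheaf_apply hb
  have key : T.sub Λ b.1 = ⨆ k, T.op (w k) (T.sub Λ (h k).1) := by
    refine le_antisymm ?_ (iSup_le fun k => ?_)
    · refine le_of_forall_gt_imp_ge_of_dense fun v hv => ?_
      have hex : ∀ k, ∃ ξ, Λ ξ = 1 ∧ T.op (w k) ((h k).1 ξ) ≤ v := by
        intro k
        by_contra! hcon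
        -- By continuity, `w k & -` is at least `v` at the infimum as well.
        have hcl : IsClosed {y | v ≤ T.op (w k) y} :=
          isClosed_le continuous_const (T.cont.comp (Continuous.prodMk_right (w k)))
        have hmem : v ≤ T.op (w k) (sInf {y | v ≤ T.op (w k) y}) :=
          hcl.sInf_mem (s := {y | v ≤ T.op (w k) y}) ⟨(h k).1 fun _ => 1, (hcon _ h1).le⟩
        have hle : sInf {y | v ≤ T.op (w k) y} ≤ T.sub Λ (h k).1 :=
          (hsub (h k).2 _).2 fun ξ hξ => sInf_le (hcon ξ hξ).le
        exact ((hmem.trans (T.mono _ _ _ hle)).trans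
          (le_iSup (fun k => T.op (w k) (T.sub Λ (h k).1)) k)).not_gt hv
      choose ξ hξ hξv using hex
      obtain ⟨ζ, hζ, hζ'⟩ := hfin Finset.univ ξ hξ
      refine ((hsub b.2 _).1 le_rfl ζ hζ).trans ?_
      rw [hpt]
      exact iSup_le fun k => (T.mono _ _ _ (hmono (h k).2 (hζ' k (Finset.mem_univ k)))).trans
        (hξv k)
    · rw [hsub b.2]
      intro ξ hξ
      rw [hpt]
      exact (T.mono _ _ _ ((hsub (h k).2 _).1 le_rfl ξ hξ)).trans
        (le_iSup (fun k => T.op (w k) ((h k).1 ξ)) k)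
  intro x
  refine eq_of_forall_le_iff fun r => ?_
  change r ≤ T.imp (T.sub Λ b.1) x ↔ r ≤ T.sub w fun k => T.imp (T.sub Λ (h k).1) x
  rw [key, T.le_imp_comm, iSup_le_iff, T.le_sub_iff]
  refine forall_congr' fun k => ?_
  rw [T.le_imp_iff, T.le_imp_iff, ← T.assoc, T.comm r, T.comm _ (T.op _ _)]

end ContinuousTNorm

/-! ### Examples of conical filters, closure under multiplication, and the counterexample. -/

namespace ContinuousTNorm

variable {T : ContinuousTNorm} {X : Type u}

/-- A filter base of fuzzy sets indexed by a linear order generates a conical filter. -/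
theorem isConicalFilter_iSup_sub (T : ContinuousTNorm) {ι : Type v} [LinearOrder ι] [Nonempty ι]
    {ξ : ι → X → unitInterval} (hξ : Antitone ξ) :
    T.IsConicalFilter fun s => ⨆ i, T.sub (ξ i) s := by
  have hone : ∀ {i s}, ξ i ≤ s → ⨆ i, T.sub (ξ i) s = 1 := fun {i s} h =>
    one_le_iff_eq_one.1 ((T.sub_eq_one_iff.2 h).ge.trans (le_iSup (fun i => T.sub (ξ i) s) i))
  refine isConicalFilter_of ?_ ?_ ?_ ?_
  · exact hone (i := Classical.arbitrary ι) fun _ => unitInterval.le_one _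
  · intro s t
    rw [T.comm, ← T.le_imp_iff]
    refine iSup_le fun i => ?_
    rw [T.le_imp_iff]
    exact (T.sub_trans _ _ _).trans (le_iSup (fun i => T.sub (ξ i) t) i)
  · intro s t
    refine le_of_forall_lt fun r hr => ?_
    obtain ⟨i, hi⟩ := lt_iSup_iff.1 (lt_inf_iff.1 hr).1
    obtain ⟨j, hj⟩ := lt_iSup_iff.1 (lt_inf_iff.1 hr).2
    refine (lt_inf_iff.2 ⟨hi, hj⟩).trans_le
      (le_trans ?_ (le_iSup (fun i => T.sub (ξ i) (s ⊓ t)) (i ⊔ j)))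
    refine (T.le_sub_iff _ _ _).2 fun x => le_inf ?_ ?_
    · exact (T.op_mono (hξ le_sup_left x) inf_le_left).trans (T.sub_le _ _ x)
    · exact (T.op_mono (hξ le_sup_right x) inf_le_right).trans (T.sub_le _ _ x)
  · intro a s ha
    obtain ⟨i, hi⟩ := lt_iSup_iff.1 ha
    refine hone (i := i) fun x => ?_
    rw [T.le_imp_iff, T.comm]
    exact (T.mono _ _ _ hi.le).trans (T.sub_le _ _ x)

theorem isConicalFilter_sub (T : ContinuousTNorm) (ξ : X → unitInterval) :
    T.IsConicalFilter (T.sub ξ) := by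
  have := T.isConicalFilter_iSup_sub (ι := Unit) (ξ := fun _ => ξ) antitone_const
  simpa only [ciSup_const] using this

theorem isConicalFilter_eval (T : ContinuousTNorm) (x : X) :
    T.IsConicalFilter fun s : X → unitInterval => s x := by
  classical
  convert T.isConicalFilter_sub fun y => if y = x then (1 : unitInterval) else 0 using 2 with s
  refine eq_of_forall_le_iff fun r => ?_
  rw [T.le_sub_iff]
  constructor
  · intro h y
    split_ifs with hy
    · rwa [T.one_op, hy]
    · rw [T.comm, T.op_zero]
      exact unitInterval.nonneg _
  · intro h
    simpa only [if_true, T.one_op] using h x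

theorem IsConicalFilter.le_apply_const {Λ : (X → unitInterval) → unitInterval}
    (h : T.IsConicalFilter Λ) (r : unitInterval) : r ≤ Λ fun _ => r := by
  refine le_trans ?_ (h.op_sub_le (fun _ => 1) fun _ => r)
  rw [h.apply_one, T.one_op, T.le_sub_iff]
  exact fun _ => (T.one_op r).le

/-- For `0 < Λ s < b`, approximate `b → Λ s` by `b → c` with `c < Λ s`, then compose with `c → s`,
on which `Λ` is `1`. -/
theorem IsConicalFilter.imp_le_apply_imp {Λ : (X → unitInterval) → unitInterval}
    (h : T.IsConicalFilter Λ) (H : T.ImpContinuousOffDiagonal) {a b : unitInterval} (hab : a < b)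
    (s : X → unitInterval) : T.imp b (Λ s) ≤ Λ fun x => T.imp a (s x) := by
  rcases le_or_gt b (Λ s) with hb | hb
  · rw [h.apply_imp_eq_one (hab.trans_le hb)]
    exact unitInterval.le_one _
  refine le_trans ?_ (h.mono fun x => T.imp_mono hab.le le_rfl)
  rcases (show 0 ≤ Λ s from unitInterval.nonneg _).eq_or_lt with h0 | h0
  · rw [← h0]
    exact (h.le_apply_const _).trans (h.mono fun x => T.imp_mono le_rfl (unitInterval.nonneg _))
  · refine le_of_forall_lt fun r hr => ?_
    obtain ⟨c, hc, hc'⟩ := H.exists_lt hb h0 hr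
    refine hc'.trans_le ?_
    have h1 := h.op_sub_le (fun x => T.imp c (s x)) fun x => T.imp b (s x)
    rw [h.apply_imp_eq_one hc, T.one_op] at h1
    refine le_trans ?_ h1
    rw [T.le_sub_iff]
    exact fun x => T.imp_trans _ _ _

theorem IsConicalFilter.mul (H : T.ImpContinuousOffDiagonal)
    {Y : Set ((X → unitInterval) → unitInterval)} (hY : ∀ Λ ∈ Y, T.IsConicalFilter Λ)
    {F : (Y → unitInterval) → unitInterval} (hF : T.IsConicalFilter F) :
    T.IsConicalFilter fun s => F fun Λ => Λ.1 s := by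
  refine isConicalFilter_of ?_ ?_ ?_ ?_
  · exact (congrArg F (funext fun Λ => (hY _ Λ.2).apply_one)).trans hF.apply_one
  · intro s t
    refine (T.mono _ _ _ ?_).trans (hF.op_sub_le (fun Λ => Λ.1 s) fun Λ => Λ.1 t)
    exact (T.le_sub_iff _ _ _).2 fun Λ => (hY _ Λ.2).op_sub_le s t
  · intro s t
    exact (hF.inf_le _ _).trans (hF.mono fun Λ => (hY _ Λ.2).inf_le s t)
  · intro a s ha
    -- The intermediate `b` leaves the strict gap that `imp_le_apply_imp` requires.
    obtain ⟨b, hab, hb⟩ := exists_between ha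
    rw [← one_le_iff_eq_one, ← hF.apply_imp_eq_one hb]
    exact hF.mono fun Λ => (hY _ Λ.2).imp_le_apply_imp H hab s

theorem exists_conicalFilter_of_not_impContinuousOffDiagonal (h : ¬ T.ImpContinuousOffDiagonal) :
    ∃ Λ : (ULift.{u} unitInterval → unitInterval) → unitInterval, T.IsConicalFilter Λ ∧
      ∃ (t a : unitInterval) (s : ULift.{u} unitInterval → unitInterval),
        a < T.imp t (Λ s) ∧ Λ (fun x => T.imp a (s x)) < t := by
  have h1 : ∃ b s r : unitInterval, s < b ∧ 0 < s ∧ r < T.imp b s ∧ ∀ c < s, T.imp b c ≤ r := by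
    by_contra! hcon
    exact h (T.impContinuousOffDiagonal_of_forall_exists hcon)
  obtain ⟨a, s, r, hsa, hs, hr, hc⟩ := h1
  -- `1 → -` is the identity and cannot jump.
  have ha : a < 1 := by
    refine lt_of_le_of_ne (unitInterval.le_one _) fun h => ?_
    simp only [h, T.one_imp] at hr hc
    exact (le_of_forall_lt_imp_le_of_dense hc).not_gt hr
  -- Right continuity in the first argument moves the jump to `b > a`, making the required
  -- inequality strict.
  obtain ⟨b, hab, hb⟩ := T.exists_lt_imp_of_lt_imp hsa ha hr
  classical
  -- The generated filter gives the identity a value at least `s`, but gives `a → -` at most `r`, as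
  -- testing at `x = c` shows.
  let ξ : Set.Iio s → ULift.{u} unitInterval → unitInterval :=
    fun c x => if c.1 ≤ x.down ∧ x.down < s then 1 else 0
  have hξ : Antitone ξ := by
    intro c d hcd x
    dsimp only [ξ]
    split_ifs with h1 h2
    · exact le_rfl
    · exact absurd ⟨(show c.1 ≤ d.1 from hcd).trans h1.1, h1.2⟩ h2
    · exact unitInterval.nonneg _
    · exact le_rfl
  have : Nonempty (Set.Iio s) := ⟨⟨0, hs⟩⟩
  refine ⟨_, T.isConicalFilter_iSup_sub hξ, T.imp b s, a, ULift.down, ?_, ?_⟩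
  · refine hab.trans_le (T.le_imp_comm.1 (T.imp_mono le_rfl ?_))
    refine le_of_forall_lt_imp_le_of_dense fun c hc => ?_
    refine le_trans ?_ (le_iSup _ (⟨c, hc⟩ : Set.Iio s))
    refine (T.le_sub_iff _ _ _).2 fun x => ?_
    dsimp only [ξ]
    split_ifs with h1
    · rw [T.one_op]
      exact h1.1
    · rw [T.comm, T.op_zero]
      exact unitInterval.nonneg _
  · refine (iSup_le fun c => ?_).trans_lt hb
    refine le_trans ?_ (hc c.1 c.2)
    have h2 := T.sub_le (ξ c) (fun x => T.imp a x.down) ⟨c.1⟩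
    simp only [ξ] at h2
    rwa [if_pos ⟨le_rfl, c.2⟩, T.one_op] at h2

end ContinuousTNorm

/-! ### The submonad condition and the equivalence. -/

theorem isSubmonad_iff (T : ContinuousTNorm) :
    IsSubmonad doubleFuzzyPowerset.{u} T.conicalFilterFunctor ↔
      ∀ (X : Type u) (F : (T.conicalFilterFunctor.obj X → unitInterval) → unitInterval),
        T.IsConicalFilter F → T.IsConicalFilter fun s => F fun Λ => Λ.1 s := by
  constructor
  · rintro ⟨-, m, hm⟩ X F hF
    have h1 := ConcreteCategory.congr_hom (NatTrans.congr_app hm X)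
      (⟨F, hF⟩ : T.conicalFilterFunctor.toFunctor.obj (T.conicalFilterFunctor.toFunctor.obj X))
    have h2 := (m.app X
      (⟨F, hF⟩ : T.conicalFilterFunctor.toFunctor.obj (T.conicalFilterFunctor.toFunctor.obj X))).2
    change T.IsConicalFilter _ at h2
    rwa [show (fun s => F fun Λ => Λ.1 s) = _ from h1.symm]
  · intro h
    -- Point evaluations are always conical filters, so only the multiplication imposes a condition.
    refine ⟨⟨{ app := fun X => TypeCat.ofHom fun x => ⟨_, T.isConicalFilter_eval x⟩ }, ?_⟩,
      ⟨{ app := fun X => TypeCat.ofHom fun F => ⟨_, h X F.1 F.2⟩ }, ?_⟩⟩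
    · rfl
    · rfl

theorem mainTheorem4 (T : ContinuousTNorm) :
    T.ImpContinuousOffDiagonal ↔
      IsSubmonad doubleFuzzyPowerset.{u} T.conicalFilterFunctor := by
  rw [isSubmonad_iff]
  constructor
  · intro H X F hF
    exact hF.mul H fun Λ hΛ => hΛ
  · intro H
    by_contra hcon
    obtain ⟨Λ, hΛ, t, a, s, ha, ht⟩ :=
      ContinuousTNorm.exists_conicalFilter_of_not_impContinuousOffDiagonal.{u} hcon
    classical
    -- The principal filter of this fuzzy singleton of height `t` at `Λ` multiplies to `q ↦ t → Λ
    -- q`. At `s` this exceeds `a`, yet at `a → s` it is not `1`.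
    let ξ : T.conicalFilterFunctor.obj (ULift.{u} unitInterval) → unitInterval :=
      fun Γ => if Γ.1 = Λ then t else 0
    have hval : ∀ q : ULift.{u} unitInterval → unitInterval,
        T.sub ξ (fun Γ => Γ.1 q) = T.imp t (Λ q) := by
      intro q
      refine eq_of_forall_le_iff fun r => ?_
      rw [T.le_sub_iff, T.le_imp_iff]
      constructor
      · intro h
        have h1 : ξ ⟨Λ, hΛ⟩ = t := if_pos rfl
        rw [← h1]
        exact h ⟨Λ, hΛ⟩
      · intro h Γ
        dsimp only [ξ]
        split_ifs with h1
        · rwa [h1]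
        · rw [T.comm, T.op_zero]
          exact unitInterval.nonneg _
    have h1 := H _ _ (T.isConicalFilter_sub ξ)
    simp only [hval] at h1
    exact (T.imp_eq_one_iff.1 (h1.apply_imp_eq_one ha)).not_gt ht
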